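/- Conventions. A \emph{lex category} is a category $\mathcal C$ with, for every finite category $I$ and every functor $K : I \to \mathcal C$, a chosen limit cone $\lim_I K$, such that for all finite categories $I, J$ and every $H : I \times J \to \mathcal C$ the canonical isomorphism $$\lim_{i : I} \lim_{j : J} H(i,j) \longrightarrow \lim_{j : J} \lim_{i : I} H(i,j)$$ is an identity (in particular, its source and target are equal). Morphisms of lex categories are the functors that send the chosen limit cones to the chosen limit cones, on the nose; this gives a category $\mathrm{Lex}$. (For size reasons the finite categories $I$ range over a fixed universe, and $\mathrm{Cat}$ and $\mathrm{Lex}$ consist of categories with a set of objects in a strictly larger universe.) Let $F : \mathrm{Cat} \to \mathrm{Lex}$ be the left adjoint of the forgetful functor $U : \mathrm{Lex} \to \mathrm{Cat}$, with unit $\iota_{\mathcal C} : \mathcal C \to U F(\mathcal C)$. The category $\mathrm{Lex}$ is monoidal: $\mathcal C \otimes \mathcal D$ is the free lex category generated by a functor $\otimes : \mathcal C \times \mathcal D \to \mathcal C \otimes \mathcal D$ such that each functor $- \otimes d$ and each functor $c \otimes -$ preserves the chosen limit cones; the unit $1$ is the free lex category generated by one object, i.e. $1 = F(\top)$ with $\top$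 the terminal category; and the coherence isomorphisms are those induced by $(c \otimes d) \otimes e \mapsto c \otimes (d \otimes e)$, $* \otimes c \mapsto c$ and $c \otimes * \mapsto c$, where $*$ is the generator of $1$. A \emph{notion of parametricity for categories} is a monoid in $\mathrm{Cat}$ with its cartesian product, i.e. a strict monoidal category; a \emph{notion of parametricity for lex categories} is a monoid in $(\mathrm{Lex}, \otimes, 1)$. Statement. The functor $F$ is strong monoidal from $(\mathrm{Cat}, \times, \top)$ to $(\mathrm{Lex}, \otimes, 1)$: there are isomorphisms $\varepsilon : 1 \to F(\top)$ and $\mu_{\mathcal C, \mathcal D} : F(\mathcal C) \otimes F(\mathcal D) \to F(\mathcal C \times \mathcal D)$ in $\mathrm{Lex}$, natural in $\mathcal C$ and $\mathcal D$ and satisfying the associativity and unit axioms of a monoidal functor, where $\varepsilon$ is the identity and $\mu_{\mathcal C, \mathcal D}$ satisfies $\mu_{\mathcal C, \mathcal D} \circ \otimes \circ (\iota_{\mathcal C} \times \iota_{\mathcal D}) = \iota_{\mathcal C \times \mathcal D}$. As a consequence, for every strict monoidal category $\mathcal M$, with multiplication $m : \mathcal M \times \mathcal M \to \mathcal M$ and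 unit $e : \top \to \mathcal M$, the lex category $F(\mathcal M)$ is a notion of parametricity for lex categories, with multiplication $F(m) \circ \mu_{\mathcal M, \mathcal M}$ and unit $F(e) \circ \varepsilon$. -/

import Mathlib

open CategoryTheory Limits MonoidalCategory

universe v v' u w u₁ u₂ u₃ u₄ u₅

/-- A choice of limit cone for every diagram indexed by a finite category. -/
structure ChosenFiniteLimits (C : Type u) [Category.{v} C] where
  lim : ∀ (I : Type) [SmallCategory I] [FinCategory I] (K : I ⥤ C), LimitCone K

namespace ChosenFiniteLimits

variable {C : Type u} [Category.{v} C] (L : ChosenFiniteLimits C)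
  {I J : Type} [SmallCategory I] [FinCategory I] [SmallCategory J] [FinCategory J]

/-- The functor `i ↦ lim_j H(i, j)`. A diagram on `I × J` is given in curried form. -/
def innerLim (H : I ⥤ J ⥤ C) : I ⥤ C where
  obj i := (L.lim J (H.obj i)).cone.pt
  map {i i'} f := (L.lim J (H.obj i')).isLimit.lift
    ((Cone.postcompose (H.map f)).obj (L.lim J (H.obj i)).cone)
  map_id i := (L.lim J (H.obj i)).isLimit.hom_ext fun j => by simp
  map_comp {_ _ i''} f g := (L.lim J (H.obj i'')).isLimit.hom_ext fun j => by simp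

/-- The projection `lim_i lim_j H(i, j) ⟶ lim_j H(i, j)`. -/
def outer (H : I ⥤ J ⥤ C) (i : I) :
    (L.lim I (L.innerLim H)).cone.pt ⟶ (L.lim J (H.obj i)).cone.pt :=
  (L.lim I (L.innerLim H)).cone.π.app i

/-- The projection `lim_i lim_j H(i, j) ⟶ H(i, j)`. -/
def proj (H : I ⥤ J ⥤ C) (i : I) (j : J) :
    (L.lim I (L.innerLim H)).cone.pt ⟶ (H.obj i).obj j :=
  L.outer H i ≫ (L.lim J (H.obj i)).cone.π.app j

theorem proj_map_left (H : I ⥤ J ⥤ C) {i i' : I} (f : i ⟶ i') (j : J) :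
    L.proj H i j ≫ (H.map f).app j = L.proj H i' j := by
  let m : (L.lim J (H.obj i)).cone.pt ⟶ (L.lim J (H.obj i')).cone.pt := (L.innerLim H).map f
  have h : L.outer H i ≫ m = L.outer H i' := (L.lim I (L.innerLim H)).cone.w f
  have h2 : m ≫ (L.lim J (H.obj i')).cone.π.app j =
      (L.lim J (H.obj i)).cone.π.app j ≫ (H.map f).app j :=
    (L.lim J (H.obj i')).isLimit.fac _ j
  have h3 : (L.outer H i ≫ m) ≫ (L.lim J (H.obj i')).cone.π.app j =
      (L.outer H i ≫ (L.lim J (H.obj i)).cone.π.app j) ≫ (H.map f).app j :=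
    (Category.assoc _ _ _).trans
      ((congrArg (L.outer H i ≫ ·) h2).trans (Category.assoc _ _ _).symm)
  rw [h] at h3
  exact h3.symm

theorem proj_map_right (H : I ⥤ J ⥤ C) (i : I) {j j' : J} (g : j ⟶ j') :
    L.proj H i j ≫ (H.obj i).map g = L.proj H i j' :=
  (Category.assoc _ _ _).trans (congrArg (L.outer H i ≫ ·) ((L.lim J (H.obj i)).cone.w g))

/-- The canonical morphism `lim_i lim_j H(i, j) ⟶ lim_i H(i, j)`, for fixed `j`. -/
def swapInner (H : I ⥤ J ⥤ C) (j : J) :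
    (L.lim I (L.innerLim H)).cone.pt ⟶ (L.lim I (H.flip.obj j)).cone.pt :=
  (L.lim I (H.flip.obj j)).isLimit.lift
    { pt := (L.lim I (L.innerLim H)).cone.pt
      π :=
        { app := fun i => L.proj H i j
          naturality := fun _ _ f =>
            (Category.id_comp _).trans (L.proj_map_left H f j).symm } }

theorem swapInner_π (H : I ⥤ J ⥤ C) (i : I) (j : J) :
    L.swapInner H j ≫ (L.lim I (H.flip.obj j)).cone.π.app i = L.proj H i j :=
  IsLimit.fac _ _ _

theorem swapInner_map (H : I ⥤ J ⥤ C) {j j' : J} (g : j ⟶ j') :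
    L.swapInner H j ≫ (L.innerLim H.flip).map g = L.swapInner H j' := by
  refine (L.lim I (H.flip.obj j')).isLimit.hom_ext fun i => ?_
  let m : (L.lim I (H.flip.obj j)).cone.pt ⟶ (L.lim I (H.flip.obj j')).cone.pt :=
    (L.innerLim H.flip).map g
  have h2 : m ≫ (L.lim I (H.flip.obj j')).cone.π.app i =
      (L.lim I (H.flip.obj j)).cone.π.app i ≫ (H.flip.map g).app i :=
    (L.lim I (H.flip.obj j')).isLimit.fac _ i
  have h3 : (L.swapInner H j ≫ m) ≫ (L.lim I (H.flip.obj j')).cone.π.app i =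
      (L.swapInner H j ≫ (L.lim I (H.flip.obj j)).cone.π.app i) ≫ (H.flip.map g).app i :=
    (Category.assoc _ _ _).trans
      ((congrArg (L.swapInner H j ≫ ·) h2).trans (Category.assoc _ _ _).symm)
  rw [swapInner_π] at h3
  exact h3.trans ((L.proj_map_right H i g).trans (L.swapInner_π H i j').symm)

/-- The canonical morphism `lim_i lim_j H(i, j) ⟶ lim_j lim_i H(i, j)`, i.e. the one that
commutes with the projections to all the `H(i, j)`. -/
def swap (H : I ⥤ J ⥤ C) :
    (L.lim I (L.innerLim H)).cone.pt ⟶ (L.lim J (L.innerLim H.flip)).cone.pt :=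
  (L.lim J (L.innerLim H.flip)).isLimit.lift
    { pt := (L.lim I (L.innerLim H)).cone.pt
      π :=
        { app := fun j => L.swapInner H j
          naturality := fun _ _ g =>
            (Category.id_comp _).trans (L.swapInner_map H g).symm } }

theorem swap_proj (H : I ⥤ J ⥤ C) (i : I) (j : J) :
    L.swap H ≫ L.proj H.flip j i = L.proj H i j := by
  have h : L.swap H ≫ L.outer H.flip j = L.swapInner H j :=
    (L.lim J (L.innerLim H.flip)).isLimit.fac _ j
  rw [← L.swapInner_π H i j, ← h]
  exact (Category.assoc _ _ _).symm

end ChosenFiniteLimits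

/-- A lex category: chosen finite limits that commute strictly with each other, i.e. the canonical
isomorphism `lim_i lim_j H(i, j) ⟶ lim_j lim_i H(i, j)` is an identity (in particular its source
and its target are equal). -/
class LexCategory (C : Type u) [Category.{v} C] extends ChosenFiniteLimits C where
  swap_eq : ∀ {I J : Type} [SmallCategory I] [FinCategory I] [SmallCategory J] [FinCategory J]
    (H : I ⥤ J ⥤ C), ∃ h, toChosenFiniteLimits.swap H = eqToHom h

/-- The chosen limit cone of a finite diagram in a lex category. -/
def limCone {C : Type u} [Category.{v} C] [LexCategory C]
    {I : Type} [SmallCategory I] [FinCategory I] (K : I ⥤ C) : Cone K :=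
  (LexCategory.toChosenFiniteLimits.lim I K).cone

/-- The chosen limit cone is a limit cone. -/
def limIsLimit {C : Type u} [Category.{v} C] [LexCategory C]
    {I : Type} [SmallCategory I] [FinCategory I] (K : I ⥤ C) : IsLimit (limCone K) :=
  (LexCategory.toChosenFiniteLimits.lim I K).isLimit

/-- Strict preservation of the chosen limit cones. -/
def PreservesChosen {C : Type u} [Category.{v} C] [LexCategory C] {D : Type w} [Category.{v} D]
    [LexCategory D] (F : C ⥤ D) : Prop :=
  ∀ (I : Type) [SmallCategory I] [FinCategory I] (K : I ⥤ C),
    F.mapCone (limCone K) = limCone (K ⋙ F)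

/-- Strict commutation of the chosen limits makes any two parallel morphisms equal. -/
instance lex_thin {C : Type u} [Category.{v} C] [LexCategory C] : Quiver.IsThin C := by
  refine fun X B => ⟨fun f g => ?_⟩
  let L := LexCategory.toChosenFiniteLimits (C := C)
  let D2 := Discrete Bool
  let H : D2 ⥤ D2 ⥤ C := (Functor.const _).obj ((Functor.const _).obj B)
  obtain ⟨h, hs⟩ := LexCategory.swap_eq H
  have e1 : L.swap H = 𝟙 _ := hs.trans (eqToHom_refl _ h)
  have e2 (i j : D2) : L.proj H i j = L.proj H j i := by
    rw [← L.swap_proj H i j, e1]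
    exact Category.id_comp _
  let Y : D2 → D2 → (X ⟶ B) := fun i _ => if i.as then f else g
  let inner (i : D2) : X ⟶ (L.lim D2 (H.obj i)).cone.pt :=
    (L.lim D2 (H.obj i)).isLimit.lift ⟨X, Discrete.natTrans (fun j => Y i j)⟩
  let t : X ⟶ (L.lim D2 (L.innerLim H)).cone.pt :=
    (L.lim D2 (L.innerLim H)).isLimit.lift ⟨X, Discrete.natTrans (fun j => inner j)⟩
  have e3 (i j : D2) : t ≫ L.proj H i j = Y i j := by
    have h1 : t ≫ (L.lim D2 (L.innerLim H)).cone.π.app i = inner i := IsLimit.fac _ _ _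
    have h2 : inner i ≫ (L.lim D2 (H.obj i)).cone.π.app j = Y i j := IsLimit.fac _ _ _
    rw [← h2, ← h1]
    exact (Category.assoc _ _ _).symm
  have := e3 ⟨true⟩ ⟨false⟩
  rw [e2, e3] at this
  simpa [Y] using this.symm

theorem functor_eq_of_thin {C : Type u} [Category.{v'} C] {D : Type w} [Category.{v} D]
    [Quiver.IsThin D] {F G : C ⥤ D} (h : ∀ x, F.obj x = G.obj x) : F = G :=
  CategoryTheory.Functor.ext h fun _ _ _ => Subsingleton.elim _ _

theorem cone_eq_of_thin {I : Type} [SmallCategory I] {D : Type w} [Category.{v} D]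
    [Quiver.IsThin D] {K : I ⥤ D} {c c' : Cone K} (h : c.pt = c'.pt) : c = c' := by
  cases c; cases c'
  dsimp only at h
  subst h
  congr 1
  ext i
  exact Subsingleton.elim _ _

/-- A chosen limit only depends on the objects of the diagram. -/
theorem limCone_pt_congr {D : Type w} [Category.{v} D] [LexCategory D] {I : Type}
    [SmallCategory I] [FinCategory I] {K K' : I ⥤ D} (h : ∀ i, K.obj i = K'.obj i) :
    (limCone K).pt = (limCone K').pt := by
  cases functor_eq_of_thin h
  rfl

theorem preservesChosen_iff {C : Type u} [Category.{v} C] [LexCategory C] {D : Type w}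
    [Category.{v} D] [LexCategory D] (F : C ⥤ D) : PreservesChosen F ↔
    ∀ (I : Type) [SmallCategory I] [FinCategory I] (K : I ⥤ C),
      F.obj (limCone K).pt = (limCone (K ⋙ F)).pt :=
  ⟨fun h I _ _ K => congrArg Cone.pt (h I K), fun h I _ _ K => cone_eq_of_thin (h I K)⟩

/-- The functor `i ↦ lim_j H(i, j)` in a lex category. -/
abbrev lexInner {C : Type u} [Category.{v} C] [LexCategory C] {I J : Type} [SmallCategory I]
    [FinCategory I] [SmallCategory J] [FinCategory J] (H : I ⥤ J ⥤ C) : I ⥤ C :=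
  LexCategory.toChosenFiniteLimits.innerLim H

theorem lexInner_obj {C : Type u} [Category.{v} C] [LexCategory C] {I J : Type} [SmallCategory I]
    [FinCategory I] [SmallCategory J] [FinCategory J] (H : I ⥤ J ⥤ C) (i : I) :
    (lexInner H).obj i = (limCone (H.obj i)).pt := rfl

theorem lim_lim_comm {C : Type u} [Category.{v} C] [LexCategory C] {I J : Type} [SmallCategory I]
    [FinCategory I] [SmallCategory J] [FinCategory J] (H : I ⥤ J ⥤ C) :
    (limCone (lexInner H)).pt = (limCone (lexInner H.flip)).pt :=
  (LexCategory.swap_eq H).choose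

/-! ### Free lex categories on a category, subject to prescribed limit cones -/

/-- A family of cones over finite diagrams in `X`. -/
abbrev ConeFamily (X : Type u) [Category.{v} X] :=
  ∀ (I : Type) [SmallCategory I] [FinCategory I] (K : I ⥤ X), Cone K → Prop

/-- The functor `G` sends the cones of the family `S` to the chosen limit cones. -/
def Realizes {X : Type u} [Category.{v} X] (S : ConeFamily X) {E : Type w} [Category.{v} E]
    [LexCategory E] (G : X ⥤ E) : Prop :=
  ∀ (I : Type) [SmallCategory I] [FinCategory I] (K : I ⥤ X) (c : Cone K), S I K c →
    G.mapCone c = limCone (K ⋙ G)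

/-- Formal iterated finite limits of elements of `X`. -/
inductive LimTerm (X : Type (u + 1)) : Type (u + 1)
  | gen (x : X) : LimTerm X
  | lim (I : Type) [SmallCategory I] [FinCategory I] (t : I → LimTerm X) : LimTerm X

namespace LimTerm

variable {X : Type (u + 1)} {E : Type (u + 1)} [Category.{v} E] [LexCategory E]

open Classical in
/-- Evaluation of a formal limit in a lex category; it is undefined when the formal limit has a
subterm whose components do not form a diagram. -/
noncomputable def eval (G : X → E) : LimTerm X → Option E
  | gen x => some (G x)
  | lim I t =>
    if h : ∃ K : I ⥤ E, ∀ i, eval G (t i) = some (K.obj i) then some (limCone h.choose).pt else none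

theorem eval_gen (G : X → E) (x : X) : eval G (gen x) = some (G x) := by
  rw [eval]

theorem eval_lim (G : X → E) {I : Type} [SmallCategory I] [FinCategory I] (t : I → LimTerm X)
    (K : I ⥤ E) (h : ∀ i, eval G (t i) = some (K.obj i)) :
    eval G (lim I t) = some (limCone K).pt := by
  have hK : ∃ K : I ⥤ E, ∀ i, eval G (t i) = some (K.obj i) := ⟨K, h⟩
  rw [eval, dif_pos hK]
  exact congrArg some (limCone_pt_congr fun i =>
    Option.some.inj ((hK.choose_spec i).symm.trans (h i)))

theorem exists_of_eval_lim (G : X → E) {I : Type} [SmallCategory I] [FinCategory I]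
    (t : I → LimTerm X) (h : (eval G (lim I t)).isSome) :
    ∃ K : I ⥤ E, ∀ i, eval G (t i) = some (K.obj i) := by
  by_contra hK
  rw [eval, dif_neg hK] at h
  exact absurd h (by simp)

end LimTerm

section Free

variable {X : Type (u + 1)} [Category.{v} X]

/-- A lex category with a functor from `X` that realizes `S`. -/
structure LexModel (S : ConeFamily X) where
  carrier : Type (u + 1)
  [cat : Category.{v} carrier]
  [lex : LexCategory carrier]
  G : X ⥤ carrier
  realizes : Realizes S G

attribute [instance] LexModel.cat LexModel.lex

variable (S : ConeFamily X)

/-- Formal limits that are defined in every model. -/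
def WfTerm : Type (u + 1) :=
  { t : LimTerm X // ∀ M : LexModel.{v, u} S, (t.eval M.G.obj).isSome }

variable {S}

noncomputable def WfTerm.val (M : LexModel.{v, u} S) (t : WfTerm S) : M.carrier :=
  (t.1.eval M.G.obj).get (t.2 M)

theorem WfTerm.eval_eq (M : LexModel.{v, u} S) (t : WfTerm S) :
    t.1.eval M.G.obj = some (t.val M) := by
  simp [WfTerm.val]

variable (S)

/-- Formal limits are identified when they are equal in every model. -/
instance wfSetoid : Setoid (WfTerm S) where
  r s t := ∀ M : LexModel.{v, u} S, s.val M = t.val M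
  iseqv := ⟨fun _ _ => rfl, fun h M => (h M).symm, fun h k M => (h M).trans (k M)⟩

/-- The free lex category generated by `X` such that the cones in `S` become chosen limit cones.
Its objects are the formal iterated finite limits of objects of `X`, two of them being identified
when they agree in every lex category under `X` in which they can be interpreted and in which
the cones in `S` are chosen limit cones; it has a
(necessarily unique) morphism between two of them when there is one in all these lex categories.
See `existsUnique_lift` below for the universal property. -/
def FreeLex : Type (u + 1) := Quotient (wfSetoid S)

namespace FreeLex

variable {S}

/-- Interpretation in a model, on objects. -/
noncomputable def val (M : LexModel.{v, u} S) : FreeLex S → M.carrier :=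
  Quotient.lift (fun t => t.val M) fun _ _ h => h M

theorem ext_val {a b : FreeLex S} (h : ∀ M : LexModel.{v, u} S, a.val M = b.val M) : a = b := by
  induction a using Quotient.inductionOn with | _ a => ?_
  induction b using Quotient.inductionOn with | _ b => ?_
  exact Quotient.sound h

noncomputable instance : Category.{v} (FreeLex S) where
  Hom a b := ULift.{v} (PLift (∀ M : LexModel.{v, u} S, Nonempty (a.val M ⟶ b.val M)))
  id a := ⟨⟨fun M => ⟨𝟙 _⟩⟩⟩
  comp f g := ⟨⟨fun M => ⟨(f.down.down M).some ≫ (g.down.down M).some⟩⟩⟩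

instance : Quiver.IsThin (FreeLex S) := fun _ _ => ⟨fun ⟨⟨_⟩⟩ ⟨⟨_⟩⟩ => rfl⟩

/-- Interpretation in a model, as a functor. -/
noncomputable def interp (M : LexModel.{v, u} S) : FreeLex S ⥤ M.carrier where
  obj := val M
  map f := (f.down.down M).some
  map_id _ := Subsingleton.elim _ _
  map_comp _ _ := Subsingleton.elim _ _

variable {I J : Type} [SmallCategory I] [FinCategory I] [SmallCategory J] [FinCategory J]

theorem eval_lim_out (K : I ⥤ FreeLex S) (M : LexModel.{v, u} S) :
    (LimTerm.lim I fun i => (K.obj i).out.1).eval M.G.obj = some (limCone (K ⋙ interp M)).pt := by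
  refine LimTerm.eval_lim _ _ _ fun i => ?_
  rw [WfTerm.eval_eq]
  conv_rhs => rw [Functor.comp_obj, ← Quotient.out_eq (K.obj i)]
  rfl

/-- The limit of a finite diagram of formal limits, on objects. -/
noncomputable def limObj (K : I ⥤ FreeLex S) : FreeLex S :=
  Quotient.mk _ ⟨LimTerm.lim I fun i => (K.obj i).out.1, fun M => by simp [eval_lim_out K M]⟩

theorem val_limObj (K : I ⥤ FreeLex S) (M : LexModel.{v, u} S) :
    (limObj K).val M = (limCone (K ⋙ interp M)).pt := by
  change WfTerm.val M _ = _
  simp [WfTerm.val, eval_lim_out K M]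

noncomputable def limitCone (K : I ⥤ FreeLex S) : LimitCone K where
  cone :=
    { pt := limObj K
      π :=
        { app := fun i => ⟨⟨fun M =>
            ⟨eqToHom (val_limObj K M) ≫ (limCone (K ⋙ interp M)).π.app i⟩⟩⟩
          naturality := fun _ _ _ => rfl } }
  isLimit :=
    { lift := fun c => ⟨⟨fun M =>
        ⟨(limIsLimit (K ⋙ interp M)).lift ((interp M).mapCone c) ≫
          eqToHom (val_limObj K M).symm⟩⟩⟩
      fac := fun _ _ => rfl
      uniq := fun _ _ _ => rfl }

noncomputable instance : LexCategory (FreeLex S) where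
  lim I _ _ K := limitCone K
  swap_eq {I J} _ _ _ _ H := by
    refine ⟨ext_val fun M => ?_, Subsingleton.elim _ _⟩
    refine (val_limObj _ M).trans (Eq.trans ?_ (val_limObj _ M).symm)
    let H' : I ⥤ J ⥤ M.carrier := H ⋙ (Functor.whiskeringRight J _ _).obj (interp M)
    refine Eq.trans (limCone_pt_congr (K' := lexInner H') fun i => ?_)
      ((lim_lim_comm H').trans (limCone_pt_congr fun j => ?_))
    · exact val_limObj (H.obj i) M
    · exact (val_limObj (H.flip.obj j) M).symm

theorem limCone_pt (K : I ⥤ FreeLex S) : (limCone K).pt = limObj K := rfl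

theorem interp_preserves (M : LexModel.{v, u} S) : PreservesChosen (interp M) :=
  (preservesChosen_iff _).2 fun _ _ _ K => val_limObj K M

variable (S) in
/-- The functor from the generating category. -/
noncomputable def gen : X ⥤ FreeLex S where
  obj x := Quotient.mk _ ⟨LimTerm.gen x, fun M => by simp [LimTerm.eval_gen]⟩
  map f := ⟨⟨fun M =>
    ⟨eqToHom (by change WfTerm.val M _ = _; simp [WfTerm.val, LimTerm.eval_gen]) ≫ M.G.map f ≫
      eqToHom (by change _ = WfTerm.val M _; simp [WfTerm.val, LimTerm.eval_gen])⟩⟩⟩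

theorem val_gen (x : X) (M : LexModel.{v, u} S) : ((gen S).obj x).val M = M.G.obj x := by
  change WfTerm.val M _ = _
  simp [WfTerm.val, LimTerm.eval_gen]

theorem gen_realizes : Realizes S (gen S) := by
  refine fun I _ _ K c hc => cone_eq_of_thin <| ext_val fun M => ?_
  refine (val_gen c.pt M).trans (Eq.trans ?_ (val_limObj _ M).symm)
  refine (congrArg Cone.pt (M.realizes I K c hc)).trans (limCone_pt_congr fun i => ?_)
  exact (val_gen (K.obj i) M).symm

/-- Every object is an iterated chosen finite limit of generators. -/
theorem induction {P : FreeLex S → Prop} (hgen : ∀ x, P ((gen S).obj x))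
    (hlim : ∀ (I : Type) [SmallCategory I] [FinCategory I] (K : I ⥤ FreeLex S),
      (∀ i, P (K.obj i)) → P (limCone K).pt) (a : FreeLex S) : P a := by
  induction a using Quotient.inductionOn with | _ a => ?_
  obtain ⟨t, ht⟩ := a
  induction t with
  | gen x => exact hgen x
  | lim I t ih =>
    have hK (M : LexModel.{v, u} S) := LimTerm.exists_of_eval_lim _ _ (ht M)
    have ht' (i : I) (M : LexModel.{v, u} S) : ((t i).eval M.G.obj).isSome := by
      rw [(hK M).choose_spec i]; rfl
    have hv (i : I) (M : LexModel.{v, u} S) :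
        WfTerm.val M ⟨t i, ht' i⟩ = (hK M).choose.obj i :=
      Option.some.inj ((WfTerm.eval_eq M ⟨t i, ht' i⟩).symm.trans ((hK M).choose_spec i))
    let K : I ⥤ FreeLex S :=
      { obj := fun i => Quotient.mk _ ⟨t i, ht' i⟩
        map := fun {i j} f => ⟨⟨fun M =>
          ⟨eqToHom (hv i M) ≫ (hK M).choose.map f ≫ eqToHom (hv j M).symm⟩⟩⟩
        map_id := fun _ => rfl
        map_comp := fun _ _ => rfl }
    have : (Quotient.mk _ ⟨LimTerm.lim I t, ht⟩ : FreeLex S) = (limCone K).pt := by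
      refine ext_val fun M => Eq.trans ?_ (val_limObj K M).symm
      refine Option.some.inj ((WfTerm.eval_eq M ⟨LimTerm.lim I t, ht⟩).symm.trans ?_)
      exact LimTerm.eval_lim _ _ _ fun i => WfTerm.eval_eq M ⟨t i, ht' i⟩
    rw [this]
    exact hlim I K fun i => ih i (ht' i)

variable {E : Type (u + 1)} [Category.{v} E] [LexCategory E]

/-- The lex functor out of the free lex category induced by a functor that realizes `S`. -/
noncomputable def lift (G : X ⥤ E) (hG : Realizes S G) : FreeLex S ⥤ E :=
  interp (M := ⟨E, G, hG⟩)

theorem lift_preserves (G : X ⥤ E) (hG : Realizes S G) : PreservesChosen (lift G hG) :=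
  interp_preserves _

theorem lift_gen (G : X ⥤ E) (hG : Realizes S G) (x : X) :
    (lift G hG).obj ((gen S).obj x) = G.obj x :=
  val_gen x _

theorem hom_ext {F F' : FreeLex S ⥤ E} (hF : PreservesChosen F) (hF' : PreservesChosen F')
    (h : ∀ x, F.obj ((gen S).obj x) = F'.obj ((gen S).obj x)) : F = F' := by
  refine functor_eq_of_thin fun a =>
    induction (P := fun a => F.obj a = F'.obj a) h (fun I _ _ K ih => ?_) a
  rw [(preservesChosen_iff F).1 hF, (preservesChosen_iff F').1 hF']
  exact limCone_pt_congr ih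

/-- The universal property of the free lex category. -/
theorem existsUnique_lift (G : X ⥤ E) (hG : Realizes S G) :
    ∃! F : FreeLex S ⥤ E, PreservesChosen F ∧ gen S ⋙ F = G :=
  ⟨lift G hG, ⟨lift_preserves G hG, functor_eq_of_thin (lift_gen G hG)⟩, fun F hF =>
    hom_ext hF.1 (lift_preserves G hG) fun x => by
      rw [lift_gen, ← hF.2]; rfl⟩

end FreeLex

end Free

/-! ### The category of lex categories and the free lex category on a category -/

set_option linter.checkUnivs false in
/-- Bundled lex categories. -/
structure LexCat : Type (max (u + 1) (v + 1)) where
  carrier : Type u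
  [cat : Category.{v} carrier]
  [lex : LexCategory carrier]

attribute [instance] LexCat.cat LexCat.lex

namespace LexCat

/-- Morphisms of lex categories: functors preserving the chosen limit cones. -/
@[ext]
structure Hom (C D : LexCat.{v, u}) where
  toFunctor : C.carrier ⥤ D.carrier
  preserves : PreservesChosen toFunctor

theorem preserves_id (C : LexCat.{v, u}) : PreservesChosen (𝟭 C.carrier) :=
  fun _ _ _ _ => rfl

theorem preserves_comp {C D E : LexCat.{v, u}} {F : C.carrier ⥤ D.carrier}
    {G : D.carrier ⥤ E.carrier} (hF : PreservesChosen F) (hG : PreservesChosen G) :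
    PreservesChosen (F ⋙ G) :=
  fun I _ _ K => (congrArg (Functor.mapCone G) (hF I K)).trans (hG I (K ⋙ F))

instance : Category LexCat.{v, u} where
  Hom := Hom
  id C := ⟨𝟭 _, preserves_id C⟩
  comp f g := ⟨f.toFunctor ⋙ g.toFunctor, preserves_comp f.preserves g.preserves⟩

@[simp] theorem id_toFunctor (C : LexCat.{v, u}) : Hom.toFunctor (𝟙 C) = 𝟭 C.carrier := rfl

@[simp] theorem comp_toFunctor {C D E : LexCat.{v, u}} (f : C ⟶ D) (g : D ⟶ E) :
    Hom.toFunctor (f ≫ g) = f.toFunctor ⋙ g.toFunctor := rfl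

theorem hom_ext_obj {C D : LexCat.{v, u}} {f g : C ⟶ D}
    (h : ∀ x, f.toFunctor.obj x = g.toFunctor.obj x) : f = g :=
  Hom.ext (functor_eq_of_thin h)

/-- The forgetful functor to categories. -/
def forget : LexCat.{v, u} ⥤ Cat.{v, u} where
  obj C := Cat.of C.carrier
  map f := f.toFunctor.toCatHom

/-- The empty family of cones. -/
def noCones (X : Type u) [Category.{v} X] : ConeFamily X := fun _ _ _ _ _ => False

theorem realizes_noCones {X : Type u} [Category.{v} X] {E : Type w} [Category.{v} E]
    [LexCategory E] (G : X ⥤ E) : Realizes (noCones X) G :=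
  fun _ _ _ _ _ h => h.elim

/-- The free lex category on a category. -/
noncomputable def freeObj (X : Cat.{v, u + 1}) : LexCat.{v, u + 1} := ⟨FreeLex (noCones X)⟩

/-- The inclusion of a category in the free lex category on it. -/
noncomputable def incl (X : Cat.{v, u + 1}) : X ⥤ (freeObj X).carrier := FreeLex.gen (noCones X)

/-- The extension of a functor to the free lex category. -/
noncomputable def freeLift {X : Cat.{v, u + 1}} {E : LexCat.{v, u + 1}} (G : X ⥤ E.carrier) :
    freeObj X ⟶ E :=
  ⟨FreeLex.lift G (realizes_noCones G), FreeLex.lift_preserves _ _⟩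

theorem freeLift_incl {X : Cat.{v, u + 1}} {E : LexCat.{v, u + 1}} (G : X ⥤ E.carrier) (x : X) :
    (freeLift G).toFunctor.obj ((incl X).obj x) = G.obj x :=
  FreeLex.lift_gen _ _ _

theorem free_hom_ext {X : Cat.{v, u + 1}} {E : LexCat.{v, u + 1}} {f g : freeObj X ⟶ E}
    (h : ∀ x, f.toFunctor.obj ((incl X).obj x) = g.toFunctor.obj ((incl X).obj x)) : f = g :=
  Hom.ext (FreeLex.hom_ext f.preserves g.preserves h)

/-- The functor `F : Cat ⥤ Lex` freely adding finite limits. -/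
noncomputable def free : Cat.{v, u + 1} ⥤ LexCat.{v, u + 1} where
  obj := freeObj
  map {_ Y} f := freeLift (f.toFunctor ⋙ incl Y)
  map_id _ := free_hom_ext fun x => freeLift_incl _ x
  map_comp {_ Y Z} f g := free_hom_ext fun x => (freeLift_incl _ x).trans
    ((congrArg (freeLift (g.toFunctor ⋙ incl Z)).toFunctor.obj
      (freeLift_incl (f.toFunctor ⋙ incl Y) x)).trans (freeLift_incl _ _)).symm

/-- `free` is left adjoint to the forgetful functor, with unit given by `incl`. -/
noncomputable def freeAdj : free.{v, u} ⊣ forget.{v, u + 1} :=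
  Adjunction.mkOfHomEquiv
    { homEquiv := fun X E =>
        { toFun := fun f => (incl X ⋙ f.toFunctor).toCatHom
          invFun := fun G => freeLift G.toFunctor
          left_inv := fun _ => free_hom_ext fun x => freeLift_incl _ x
          right_inv := fun _ => Cat.Hom.ext
            (functor_eq_of_thin (D := E.carrier) fun x => freeLift_incl _ x) }
      homEquiv_naturality_left_symm := fun {_ X _} f g => free_hom_ext fun x =>
        (freeLift_incl _ x).trans ((congrArg (freeLift g.toFunctor).toFunctor.obj
          (freeLift_incl (f.toFunctor ⋙ incl X) x)).trans (freeLift_incl _ _)).symm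
      homEquiv_naturality_right := fun _ _ => rfl }

theorem freeAdj_unit (X : Cat.{v, u + 1}) : (freeAdj.unit.app X).toFunctor = incl X :=
  functor_eq_of_thin (D := (freeObj X).carrier) fun _ => rfl

/-! ### The tensor product of lex categories -/

section Bilex

variable {C : Type u₁} [Category.{v} C] [LexCategory C] {D : Type u₂} [Category.{v} D]
  [LexCategory D] {E : Type u₃} [Category.{v} E] [LexCategory E]

/-- The functor `B : C × D ⥤ E` preserves the chosen limit cones in each variable. -/
def IsBilex (B : C × D ⥤ E) : Prop :=
  (∀ d, PreservesChosen (Prod.sectL C d ⋙ B)) ∧ ∀ c, PreservesChosen (Prod.sectR c D ⋙ B)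

/-- The cones `(lim_i c_i, d)` and `(c, lim_j d_j)` in `C × D`. -/
inductive BilexCones (C : Type u₁) [Category.{v} C] [LexCategory C] (D : Type u₂) [Category.{v} D]
    [LexCategory D] : ConeFamily (C × D)
  | left (I : Type) [SmallCategory I] [FinCategory I] (K : I ⥤ C) (d : D) :
      BilexCones C D I (K ⋙ Prod.sectL C d) ((Prod.sectL C d).mapCone (limCone K))
  | right (J : Type) [SmallCategory J] [FinCategory J] (c : C) (K : J ⥤ D) :
      BilexCones C D J (K ⋙ Prod.sectR c D) ((Prod.sectR c D).mapCone (limCone K))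

theorem realizes_bilexCones_iff (B : C × D ⥤ E) : Realizes (BilexCones C D) B ↔ IsBilex B := by
  constructor
  · exact fun h => ⟨fun d I _ _ K => h I _ _ (.left I K d), fun c I _ _ K => h I _ _ (.right I c K)⟩
  · rintro ⟨h1, h2⟩ I _ _ _ _ (⟨I, K, d⟩ | ⟨I, c, K⟩)
    · exact h1 d _ K
    · exact h2 c _ K

theorem IsBilex.swap {B : C × D ⥤ E} (h : IsBilex B) : IsBilex (CategoryTheory.Prod.swap D C ⋙ B) :=
  ⟨h.2, h.1⟩

theorem IsBilex.comp {B : C × D ⥤ E} (h : IsBilex B) {E' : Type u₄} [Category.{v} E']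
    [LexCategory E'] {F : E ⥤ E'} (hF : PreservesChosen F) : IsBilex (B ⋙ F) :=
  ⟨fun d I _ _ K => (congrArg F.mapCone (h.1 d I K)).trans (hF I _),
    fun c I _ _ K => (congrArg F.mapCone (h.2 c I K)).trans (hF I _)⟩

theorem IsBilex.precomp {B : C × D ⥤ E} (h : IsBilex B) {C' : Type u₄} [Category.{v} C']
    [LexCategory C'] {D' : Type u₅} [Category.{v} D'] [LexCategory D'] {F : C' ⥤ C}
    (hF : PreservesChosen F) {G : D' ⥤ D} (hG : PreservesChosen G) : IsBilex (F.prod G ⋙ B) := by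
  constructor
  · refine fun d => (preservesChosen_iff _).2 fun I _ _ K => ?_
    change B.obj (F.obj (limCone K).pt, G.obj d) = _
    rw [(preservesChosen_iff F).1 hF]
    exact ((preservesChosen_iff _).1 (h.1 (G.obj d)) I (K ⋙ F)).trans
      (limCone_pt_congr fun _ => rfl)
  · refine fun c => (preservesChosen_iff _).2 fun I _ _ K => ?_
    change B.obj (F.obj c, G.obj (limCone K).pt) = _
    rw [(preservesChosen_iff G).1 hG]
    exact ((preservesChosen_iff _).1 (h.2 (F.obj c)) I (K ⋙ G)).trans
      (limCone_pt_congr fun _ => rfl)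

end Bilex

section Extend

variable {X : Type (u + 1)} [Category.{v} X] {S : ConeFamily X} {Y : Type u₁} [Category.{v} Y]
  {E : Type (u + 1)} [Category.{v} E] [LexCategory E]
  (G : X × Y ⥤ E) (h₁ : ∀ y, Realizes S (Prod.sectL X y ⋙ G))

theorem extend_map (a : FreeLex S) {y y' : Y} (g : y ⟶ y') :
    Nonempty ((FreeLex.lift _ (h₁ y)).obj a ⟶ (FreeLex.lift _ (h₁ y')).obj a) := by
  refine FreeLex.induction (P := fun a => Nonempty ((FreeLex.lift _ (h₁ y)).obj a ⟶
    (FreeLex.lift _ (h₁ y')).obj a)) (fun x => ?_) (fun I _ _ K ih => ?_) a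
  · rw [FreeLex.lift_gen, FreeLex.lift_gen]
    exact ⟨G.map (Prod.mkHom (𝟙 x) g)⟩
  · rw [(preservesChosen_iff _).1 (FreeLex.lift_preserves _ (h₁ y)),
      (preservesChosen_iff _).1 (FreeLex.lift_preserves _ (h₁ y'))]
    exact ⟨(limIsLimit _).lift ⟨_, ⟨fun i => (limCone _).π.app i ≫ (ih i).some,
      fun _ _ _ => Subsingleton.elim _ _⟩⟩⟩

/-- Extension of a functor of two variables to the free lex category in the first variable. -/
noncomputable def extend : FreeLex S × Y ⥤ E where
  obj p := (FreeLex.lift _ (h₁ p.2)).obj p.1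
  map {p q} f := (FreeLex.lift _ (h₁ p.2)).map f.1 ≫ (extend_map G h₁ q.1 f.2).some
  map_id _ := Subsingleton.elim _ _
  map_comp _ _ := Subsingleton.elim _ _

theorem extend_gen (x : X) (y : Y) : (extend G h₁).obj ((FreeLex.gen S).obj x, y) = G.obj (x, y) :=
  FreeLex.lift_gen _ (h₁ y) x

theorem extend_bilex [LexCategory Y] (h₂ : ∀ x, PreservesChosen (Prod.sectR x Y ⋙ G)) :
    IsBilex (extend G h₁) := by
  have key (y : Y) {I : Type} [SmallCategory I] [FinCategory I] (A : I ⥤ FreeLex S) :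
      (extend G h₁).obj ((limCone A).pt, y) =
        (limCone (A ⋙ Prod.sectL _ y ⋙ extend G h₁)).pt :=
    ((preservesChosen_iff _).1 (FreeLex.lift_preserves _ (h₁ y)) I A).trans
      (limCone_pt_congr fun _ => rfl)
  refine ⟨fun y => (preservesChosen_iff _).2 fun I _ _ A => key y A,
    fun a => (preservesChosen_iff _).2 fun J _ _ K => ?_⟩
  refine FreeLex.induction (P := fun a => (extend G h₁).obj (a, (limCone K).pt) =
    (limCone (K ⋙ Prod.sectR a Y ⋙ extend G h₁)).pt) (fun x => ?_) (fun I _ _ A ih => ?_) a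
  · rw [extend_gen]
    exact ((preservesChosen_iff _).1 (h₂ x) J K).trans
      (limCone_pt_congr fun j => (extend_gen G h₁ x _).symm)
  · let H : I ⥤ J ⥤ E := Functor.curry.obj (A.prod K ⋙ extend G h₁)
    rw [key]
    refine (limCone_pt_congr (K' := lexInner H) fun i => ?_).trans
      ((lim_lim_comm H).trans (limCone_pt_congr fun j => ?_))
    · exact (ih i).trans (limCone_pt_congr fun _ => rfl)
    · exact (limCone_pt_congr fun _ => rfl).trans (key (K.obj j) A).symm

end Extend

/-- The tensor product of lex categories: the free lex category on `C × D` such that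
`tmul : C × D ⥤ C ⊗ D` preserves the chosen limit cones in each variable. -/
noncomputable def tensor (C D : LexCat.{v, u + 1}) : LexCat.{v, u + 1} :=
  ⟨FreeLex (BilexCones C.carrier D.carrier)⟩

/-- The universal functor of two variables. -/
noncomputable def tmul (C D : LexCat.{v, u + 1}) : C.carrier × D.carrier ⥤ (tensor C D).carrier :=
  FreeLex.gen _

theorem tmul_bilex (C D : LexCat.{v, u + 1}) : IsBilex (tmul C D) :=
  (realizes_bilexCones_iff _).1 FreeLex.gen_realizes

section

variable {C D E : LexCat.{v, u + 1}}

/-- The lex functor on the tensor product induced by a functor that preserves the chosen limit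
cones in each variable. -/
noncomputable def tensorLift (B : C.carrier × D.carrier ⥤ E.carrier) (hB : IsBilex B) :
    tensor C D ⟶ E :=
  ⟨FreeLex.lift B ((realizes_bilexCones_iff B).2 hB), FreeLex.lift_preserves _ _⟩

theorem tensorLift_tmul (B : C.carrier × D.carrier ⥤ E.carrier) (hB : IsBilex B)
    (p : C.carrier × D.carrier) : (tensorLift B hB).toFunctor.obj ((tmul C D).obj p) = B.obj p :=
  FreeLex.lift_gen _ _ _

theorem tensor_hom_ext {f g : tensor C D ⟶ E} (h : ∀ c d,
    f.toFunctor.obj ((tmul C D).obj (c, d)) = g.toFunctor.obj ((tmul C D).obj (c, d))) : f = g :=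
  Hom.ext (FreeLex.hom_ext f.preserves g.preserves fun p => h p.1 p.2)

/-- The universal property of the tensor product. -/
theorem existsUnique_tensorLift (B : C.carrier × D.carrier ⥤ E.carrier) (hB : IsBilex B) :
    ∃! f : tensor C D ⟶ E, tmul C D ⋙ f.toFunctor = B :=
  ⟨tensorLift B hB, functor_eq_of_thin (tensorLift_tmul B hB), fun f hf =>
    tensor_hom_ext fun c d => by rw [tensorLift_tmul, ← hf]; rfl⟩

end

theorem _root_.PreservesChosen.congr {C : Type u₁} [Category.{v} C] [LexCategory C] {D : Type u₂}
    [Category.{v} D] [LexCategory D] {F G : C ⥤ D} (hF : PreservesChosen F)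
    (h : ∀ x, F.obj x = G.obj x) : PreservesChosen G := by
  rwa [functor_eq_of_thin h] at hF

/-- The lex functor `c ⊗ _`. -/
noncomputable def tmulLeft {C : LexCat.{v, u + 1}} (c : C.carrier) (D : LexCat.{v, u + 1}) :
    D ⟶ tensor C D :=
  ⟨Prod.sectR c D.carrier ⋙ tmul C D, (tmul_bilex C D).2 c⟩

/-- The lex functor `_ ⊗ d`. -/
noncomputable def tmulRight (C : LexCat.{v, u + 1}) {D : LexCat.{v, u + 1}} (d : D.carrier) :
    C ⟶ tensor C D :=
  ⟨Prod.sectL C.carrier d ⋙ tmul C D, (tmul_bilex C D).1 d⟩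

section

variable {A B C D E A' B' C' D' : LexCat.{v, u + 1}}

@[simp] theorem tmulLeft_obj (c : C.carrier) (d : D.carrier) :
    (tmulLeft c D).toFunctor.obj d = (tmul C D).obj (c, d) := rfl

@[simp] theorem tmulRight_obj (c : C.carrier) (d : D.carrier) :
    (tmulRight C d).toFunctor.obj c = (tmul C D).obj (c, d) := rfl

theorem tensor_ext_right {f g : tensor C D ⟶ E} (h : ∀ d, tmulRight C d ≫ f = tmulRight C d ≫ g) :
    f = g :=
  tensor_hom_ext fun c d => congrArg (fun k : C ⟶ E => k.toFunctor.obj c) (h d)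

theorem tensor_ext_left {f g : tensor C D ⟶ E} (h : ∀ c, tmulLeft c D ≫ f = tmulLeft c D ≫ g) :
    f = g :=
  tensor_hom_ext fun c d => congrArg (fun k : D ⟶ E => k.toFunctor.obj d) (h c)

/-- Functoriality of the tensor product. -/
noncomputable def tensorMap (f : C ⟶ C') (g : D ⟶ D') : tensor C D ⟶ tensor C' D' :=
  tensorLift (f.toFunctor.prod g.toFunctor ⋙ tmul C' D')
    ((tmul_bilex C' D').precomp f.preserves g.preserves)

@[simp] theorem tensorMap_obj (f : C ⟶ C') (g : D ⟶ D') (c : C.carrier) (d : D.carrier) :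
    (tensorMap f g).toFunctor.obj ((tmul C D).obj (c, d)) =
      (tmul C' D').obj (f.toFunctor.obj c, g.toFunctor.obj d) :=
  tensorLift_tmul _ _ _

variable (C D E)

/-- The functor `((c, d), e) ↦ c ⊗ (d ⊗ e)`. -/
noncomputable def assocFunctor :
    (C.carrier × D.carrier) × E.carrier ⥤ (tensor C (tensor D E)).carrier :=
  prod.associator _ _ _ ⋙ (𝟭 _).prod (tmul D E) ⋙ tmul C (tensor D E)

theorem assocFunctor_realizes (e : E.carrier) :
    Realizes (BilexCones C.carrier D.carrier) (Prod.sectL _ e ⋙ assocFunctor C D E) :=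
  (realizes_bilexCones_iff _).2
    ⟨fun d => ((tmul_bilex C (tensor D E)).1 ((tmul D E).obj (d, e))).congr fun _ => rfl,
     fun c => (preserves_comp (C := D) (D := tensor D E) (E := tensor C (tensor D E))
      ((tmul_bilex D E).1 e) ((tmul_bilex C (tensor D E)).2 c)).congr fun _ => rfl⟩

noncomputable def assocHom : tensor (tensor C D) E ⟶ tensor C (tensor D E) :=
  tensorLift (extend (assocFunctor C D E) (assocFunctor_realizes C D E))
    (extend_bilex _ _ fun p => (preserves_comp (C := E) (D := tensor D E)
      (E := tensor C (tensor D E)) ((tmul_bilex D E).2 p.2)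
      ((tmul_bilex C (tensor D E)).2 p.1)).congr fun _ => rfl)

/-- The functor `((d, e), c) ↦ (c ⊗ d) ⊗ e`. -/
noncomputable def assocInvFunctor :
    (D.carrier × E.carrier) × C.carrier ⥤ (tensor (tensor C D) E).carrier :=
  CategoryTheory.Prod.swap _ _ ⋙ prod.inverseAssociator _ _ _ ⋙ (tmul C D).prod (𝟭 _) ⋙
    tmul (tensor C D) E

theorem assocInvFunctor_realizes (c : C.carrier) :
    Realizes (BilexCones D.carrier E.carrier) (Prod.sectL _ c ⋙ assocInvFunctor C D E) :=
  (realizes_bilexCones_iff _).2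
    ⟨fun e => (preserves_comp (C := D) (D := tensor C D) (E := tensor (tensor C D) E)
      ((tmul_bilex C D).2 c) ((tmul_bilex (tensor C D) E).1 e)).congr fun _ => rfl,
     fun d => ((tmul_bilex (tensor C D) E).2 ((tmul C D).obj (c, d))).congr fun _ => rfl⟩

noncomputable def assocInv : tensor C (tensor D E) ⟶ tensor (tensor C D) E :=
  tensorLift (CategoryTheory.Prod.swap _ _ ⋙
      extend (assocInvFunctor C D E) (assocInvFunctor_realizes C D E))
    (extend_bilex (assocInvFunctor C D E) (assocInvFunctor_realizes C D E)
      fun p => (preserves_comp (C := C) (D := tensor C D)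
        (E := tensor (tensor C D) E) ((tmul_bilex C D).1 p.1)
        ((tmul_bilex (tensor C D) E).1 p.2)).congr fun _ => rfl).swap

variable {C D E}

@[simp] theorem assocHom_obj (c : C.carrier) (d : D.carrier) (e : E.carrier) :
    (assocHom C D E).toFunctor.obj ((tmul (tensor C D) E).obj ((tmul C D).obj (c, d), e)) =
      (tmul C (tensor D E)).obj (c, (tmul D E).obj (d, e)) :=
  (tensorLift_tmul _ _ _).trans (extend_gen _ _ _ _)

@[simp] theorem assocInv_obj (c : C.carrier) (d : D.carrier) (e : E.carrier) :
    (assocInv C D E).toFunctor.obj ((tmul C (tensor D E)).obj (c, (tmul D E).obj (d, e))) =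
      (tmul (tensor C D) E).obj ((tmul C D).obj (c, d), e) :=
  (tensorLift_tmul _ _ _).trans
    (extend_gen (assocInvFunctor C D E) (assocInvFunctor_realizes C D E) (d, e) c)

variable (C D E) in
/-- The associator, `(c ⊗ d) ⊗ e ↦ c ⊗ (d ⊗ e)`. -/
noncomputable def assocIso : tensor (tensor C D) E ≅ tensor C (tensor D E) where
  hom := assocHom C D E
  inv := assocInv C D E
  hom_inv_id := tensor_ext_right fun e => tensor_hom_ext fun c d => by simp
  inv_hom_id := tensor_ext_left fun c => tensor_hom_ext fun d e => by simp

/-- The tensor unit: the free lex category on the terminal category. -/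
noncomputable def unit : LexCat.{v, u + 1} := free.obj (𝟙_ Cat.{v, u + 1})

/-- The generator of the tensor unit. -/
noncomputable def point : unit.{v, u}.carrier := (incl (𝟙_ Cat.{v, u + 1})).obj ⟨⟨⟨⟩⟩⟩

theorem unit_hom_ext {f g : unit ⟶ C} (h : f.toFunctor.obj point = g.toFunctor.obj point) :
    f = g :=
  free_hom_ext fun _ => h

variable (C) in
noncomputable def leftUnitorHom : tensor unit C ⟶ C :=
  tensorLift (extend (CategoryTheory.Prod.snd (𝟙_ Cat.{v, u + 1}) C.carrier)
      fun _ => realizes_noCones _)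
    (extend_bilex _ _ fun _ => preserves_id C)

@[simp] theorem leftUnitorHom_obj (c : C.carrier) :
    (leftUnitorHom C).toFunctor.obj ((tmul unit C).obj (point, c)) = c :=
  (tensorLift_tmul _ _ _).trans (extend_gen _ _ _ _)

variable (C) in
noncomputable def rightUnitorHom : tensor C unit ⟶ C :=
  tensorLift (CategoryTheory.Prod.swap _ _ ⋙
      extend (CategoryTheory.Prod.snd (𝟙_ Cat.{v, u + 1}) C.carrier)
        fun _ => realizes_noCones _)
    (extend_bilex (CategoryTheory.Prod.snd (𝟙_ Cat.{v, u + 1}) C.carrier)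
      (fun _ => realizes_noCones _) fun _ => preserves_id C).swap

@[simp] theorem rightUnitorHom_obj (c : C.carrier) :
    (rightUnitorHom C).toFunctor.obj ((tmul C unit).obj (c, point)) = c :=
  (tensorLift_tmul _ _ _).trans
    (extend_gen (CategoryTheory.Prod.snd (𝟙_ Cat.{v, u + 1}) C.carrier)
      (fun _ => realizes_noCones _) ⟨⟨⟨⟩⟩⟩ c)

variable (C) in
/-- The left unitor, `* ⊗ c ↦ c`. -/
noncomputable def leftUnitorIso : tensor unit C ≅ C where
  hom := leftUnitorHom C
  inv := tmulLeft point C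
  hom_inv_id := tensor_ext_right fun c => unit_hom_ext (by simp)
  inv_hom_id := hom_ext_obj fun c => by simp

variable (C) in
/-- The right unitor, `c ⊗ * ↦ c`. -/
noncomputable def rightUnitorIso : tensor C unit ≅ C where
  hom := rightUnitorHom C
  inv := tmulRight C point
  hom_inv_id := tensor_ext_left fun c => unit_hom_ext (by simp)
  inv_hom_id := hom_ext_obj fun c => by simp

theorem tensorMap_id : tensorMap (𝟙 C) (𝟙 D) = 𝟙 (tensor C D) :=
  tensor_hom_ext fun c d => by simp

theorem tensorMap_comp (f : A ⟶ B) (g : A' ⟶ B') (h : B ⟶ C) (k : B' ⟶ C') :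
    tensorMap f g ≫ tensorMap h k = tensorMap (f ≫ h) (g ≫ k) :=
  tensor_hom_ext fun c d => by simp

theorem assoc_naturality (f : A ⟶ A') (g : B ⟶ B') (h : C ⟶ C') :
    tensorMap (tensorMap f g) h ≫ assocHom A' B' C' =
      assocHom A B C ≫ tensorMap f (tensorMap g h) :=
  tensor_ext_right fun c => tensor_hom_ext fun a b => by simp

theorem leftUnitor_nat (f : C ⟶ D) :
    tensorMap (𝟙 unit) f ≫ leftUnitorHom D = leftUnitorHom C ≫ f :=
  tensor_ext_right fun c => unit_hom_ext (by simp)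

theorem rightUnitor_nat (f : C ⟶ D) :
    tensorMap f (𝟙 unit) ≫ rightUnitorHom D = rightUnitorHom C ≫ f :=
  tensor_ext_left fun c => unit_hom_ext (by simp)

theorem pentagon_eq :
    tensorMap (assocHom A B C) (𝟙 D) ≫ assocHom A (tensor B C) D ≫
        tensorMap (𝟙 A) (assocHom B C D) =
      assocHom (tensor A B) C D ≫ assocHom A B (tensor C D) :=
  tensor_ext_right fun d => tensor_ext_right fun c => tensor_hom_ext fun a b => by simp

theorem triangle_eq :
    assocHom C unit D ≫ tensorMap (𝟙 C) (leftUnitorHom D) = tensorMap (rightUnitorHom C) (𝟙 D) :=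
  tensor_ext_right fun d => tensor_ext_left fun c => unit_hom_ext (by simp)

end

noncomputable instance : MonoidalCategoryStruct LexCat.{v, u + 1} where
  tensorObj := tensor
  whiskerLeft C _ _ f := tensorMap (𝟙 C) f
  whiskerRight f D := tensorMap f (𝟙 D)
  tensorHom := tensorMap
  tensorUnit := unit
  associator := assocIso
  leftUnitor := leftUnitorIso
  rightUnitor := rightUnitorIso

/-- The monoidal structure on lex categories given by the tensor product. -/
noncomputable instance : MonoidalCategory LexCat.{v, u + 1} :=
  MonoidalCategory.ofTensorHom
    (id_tensorHom_id := fun _ _ => tensorMap_id)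
    (id_tensorHom := fun _ _ _ _ => rfl)
    (tensorHom_id := fun _ _ => rfl)
    (tensorHom_comp_tensorHom := tensorMap_comp)
    (associator_naturality := assoc_naturality)
    (leftUnitor_naturality := leftUnitor_nat)
    (rightUnitor_naturality := rightUnitor_nat)
    (pentagon := fun _ _ _ _ => pentagon_eq)
    (triangle := fun _ _ => triangle_eq)

end LexCat

/-! Both sides of the tensorator have the same universal property. Lex functors `free (C × D) ⟶ E`
are functors `C × D ⥤ E`. Lex functors `free C ⊗ free D ⟶ E` are functors `free C × free D ⥤ E` that
preserve chosen limits in each variable, and such a functor is determined by its restriction to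
pairs of generators. Conversely, every functor `G : C × D ⥤ E` extends: `extend` first replaces `C`
by `free C`, then `D` by `free D`.

The crux is that the second extension still preserves limits in the variable treated first. An
object of `free D` is an iterated limit of generators. By induction on it, preservation amounts to
exchanging a limit taken in `free C` with one taken in `free D`, and this exchange is an equality
because chosen limits commute strictly in `E` (`extend_bilex`, through `lim_lim_comm`).

All equations between lex functors reduce to equalities of objects. Strict commutation forces a lex
category to be thin (`lex_thin`): for the constant diagram `B` on a two by two square, the
projections of index `(i, j)` and `(j, i)` coincide, hence so do any two morphisms `X ⟶ B`. Moreover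
a lex functor on a free lex category is determined by the images of the generators (`free_hom_ext`,
`tensor_hom_ext`). So invertibility, naturality and coherence of the tensorator are checked on
tensors of generators, where they become the corresponding facts about tuples of objects in the
cartesian monoidal category `Cat`. The statement about monoids is then the general fact that a
monoidal functor carries monoids to monoids. -/

namespace LexCat

/-! ### The tensorator and its inverse. -/

section Tensorator

variable (C D : Cat.{v, u + 1})

/-- The extension of `incl (C ⊗ D)` to the free lex category in the first variable, as a functor
`(d, a) ↦ (a, d)`. -/
noncomputable def tensoratorPartial : D × (freeObj C).carrier ⥤ (freeObj (C ⊗ D)).carrier :=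
  -- `extend` acts on the first variable only; the swap puts `D` there, ready for the second
  -- extension.
  CategoryTheory.Prod.swap _ _ ⋙
    extend (X := C) (Y := D) (incl (C ⊗ D)) fun _ => realizes_noCones _

/-- For fixed `d` this functor agrees on objects with the lex extension of `c ↦ (c, d)`, and by
thinness agreement on objects is enough. -/
theorem tensoratorPartial_preserves (d : D) :
    PreservesChosen (Prod.sectR d (freeObj C).carrier ⋙ tensoratorPartial C D) :=
  (FreeLex.lift_preserves (Prod.sectL C d ⋙ (incl (C ⊗ D) : C × D ⥤ _))
    (realizes_noCones _)).congr fun _ => rfl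

/-- The functor of two variables `free C × free D ⥤ free (C × D)` inducing the tensorator. -/
noncomputable def tensoratorFunctor :
    (freeObj C).carrier × (freeObj D).carrier ⥤ (freeObj (C ⊗ D)).carrier :=
  CategoryTheory.Prod.swap _ _ ⋙
    extend (tensoratorPartial C D) fun _ => realizes_noCones _

/-- Limits in `free D` are preserved because each section is a lift. Limits in `free C` are
preserved at generators of `D` by `tensoratorPartial_preserves`, hence everywhere by the induction
inside `extend_bilex`. -/
theorem tensoratorFunctor_bilex : IsBilex (tensoratorFunctor C D) :=
  (extend_bilex _ _ (tensoratorPartial_preserves C D)).swap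

/-- The comparison `free C ⊗ free D ⟶ free (C × D)`, sending `c ⊗ d` to `(c, d)`. -/
noncomputable def tensoratorHom : tensor (freeObj C) (freeObj D) ⟶ freeObj (C ⊗ D) :=
  tensorLift (tensoratorFunctor C D) (tensoratorFunctor_bilex C D)

/-- The comparison `free (C × D) ⟶ free C ⊗ free D`, sending `(c, d)` to `c ⊗ d`. -/
noncomputable def tensoratorInv : freeObj (C ⊗ D) ⟶ tensor (freeObj C) (freeObj D) :=
  freeLift ((incl C).prod (incl D) ⋙ tmul (freeObj C) (freeObj D))

variable {C D}

theorem tensoratorPartial_obj (c : C) (d : D) :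
    (tensoratorPartial C D).obj (d, (incl C).obj c) = (incl (C ⊗ D)).obj (c, d) :=
  extend_gen (X := C) (Y := D) (incl (C ⊗ D)) (fun _ => realizes_noCones _) c d

@[simp] theorem tensoratorHom_obj (c : C) (d : D) :
    (tensoratorHom C D).toFunctor.obj
        ((tmul (freeObj C) (freeObj D)).obj ((incl C).obj c, (incl D).obj d)) =
      (incl (C ⊗ D)).obj (c, d) :=
  (tensorLift_tmul _ _ _).trans
    -- The extensions are undone in reverse order: the one along `D`, made last, is evaluated first.
    ((extend_gen (tensoratorPartial C D) (fun _ => realizes_noCones _) d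
      ((incl C).obj c)).trans (tensoratorPartial_obj c d))

@[simp] theorem tensoratorInv_obj (c : C) (d : D) :
    (tensoratorInv C D).toFunctor.obj ((incl (C ⊗ D)).obj (c, d)) =
      (tmul (freeObj C) (freeObj D)).obj ((incl C).obj c, (incl D).obj d) :=
  freeLift_incl _ _

/-! ### Reduction to generators. -/

/-- The action of `free` on morphisms. -/
noncomputable def freeMap {X Y : Cat.{v, u + 1}} (f : X ⟶ Y) : freeObj X ⟶ freeObj Y :=
  free.map f

@[simp] theorem freeMap_incl {X Y : Cat.{v, u + 1}} (f : X ⟶ Y) (x : X) :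
    (freeMap f).toFunctor.obj ((incl X).obj x) = (incl Y).obj (f.toFunctor.obj x) :=
  freeLift_incl _ _

/-- Lex functors out of `free C ⊗ E` are determined by their values on `c ⊗ e`. -/
theorem tensor_free_left_ext {E L : LexCat.{v, u + 1}} {f g : tensor (freeObj C) E ⟶ L}
    (h : ∀ c, tmulLeft ((incl C).obj c) E ≫ f = tmulLeft ((incl C).obj c) E ≫ g) : f = g :=
  -- For fixed `e`, both `c ↦ f (c ⊗ e)` and `c ↦ g (c ⊗ e)` are lex on `freeObj C`, so generators
  -- `c` suffice.
  tensor_ext_right fun e => free_hom_ext fun c =>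
    congrArg (fun k : E ⟶ L => k.toFunctor.obj e) (h c)

/-- Lex functors out of `E ⊗ free C` are determined by their values on `e ⊗ c`. -/
theorem tensor_free_right_ext {E L : LexCat.{v, u + 1}} {f g : tensor E (freeObj C) ⟶ L}
    (h : ∀ c, tmulRight E ((incl C).obj c) ≫ f = tmulRight E ((incl C).obj c) ≫ g) : f = g :=
  tensor_ext_left fun e => free_hom_ext fun c =>
    congrArg (fun k : E ⟶ L => k.toFunctor.obj e) (h c)

/-- Lex functors out of `free C ⊗ free D` are determined by their values on `c ⊗ d`. -/
theorem tensor_free_ext {L : LexCat.{v, u + 1}} {f g : tensor (freeObj C) (freeObj D) ⟶ L}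
    (h : ∀ c d,
      f.toFunctor.obj ((tmul (freeObj C) (freeObj D)).obj ((incl C).obj c, (incl D).obj d)) =
        g.toFunctor.obj ((tmul (freeObj C) (freeObj D)).obj ((incl C).obj c, (incl D).obj d))) :
    f = g :=
  tensor_free_left_ext fun c => free_hom_ext fun d => h c d

variable (C D)

/-- The tensorator of the functor `free`. -/
noncomputable def tensoratorIso : tensor (freeObj C) (freeObj D) ≅ freeObj (C ⊗ D) where
  hom := tensoratorHom C D
  inv := tensoratorInv C D
  hom_inv_id := tensor_free_ext fun c d => by simp
  inv_hom_id := free_hom_ext (X := C ⊗ D) fun ⟨c, d⟩ => by simp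

/-! ### Naturality and coherence. -/

variable {C D}

theorem tensorator_naturality {C' D' : Cat.{v, u + 1}} (f : C ⟶ C') (g : D ⟶ D') :
    tensorMap (freeMap f) (freeMap g) ≫ tensoratorHom C' D' =
      tensoratorHom C D ≫ freeMap (f ⊗ₘ g) :=
  tensor_free_ext fun c d => by
    simp only [comp_toFunctor, Functor.comp_obj, tensorMap_obj, freeMap_incl, tensoratorHom_obj]
    exact (freeMap_incl (f ⊗ₘ g) (c, d)).symm

/-- On generators both composites send `(a ⊗ b) ⊗ c` to `(a, (b, c))`. -/
theorem tensorator_associativity (A B C : Cat.{v, u + 1}) :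
    tensorMap (tensoratorHom A B) (𝟙 (freeObj C)) ≫ tensoratorHom (A ⊗ B) C ≫
        freeMap (α_ A B C).hom =
      assocHom (freeObj A) (freeObj B) (freeObj C) ≫
        tensorMap (𝟙 (freeObj A)) (tensoratorHom B C) ≫ tensoratorHom A (B ⊗ C) :=
  tensor_free_right_ext fun c => tensor_free_ext fun a b => by
    -- A pair is an object of a tensor product in `Cat` only after unfolding, so the evaluation
    -- rules are instantiated by hand for `simp`.
    have h₁ := tensoratorHom_obj (C := A ⊗ B) (D := C) (a, b) c
    have h₂ := tensoratorHom_obj (C := A) (D := B ⊗ C) a (b, c)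
    have h₃ := freeMap_incl (α_ A B C).hom ((a, b), c)
    simp [h₁, h₂, h₃]
    -- The associator of `Cat` rebrackets triples of objects by definition.
    rfl

theorem tensorator_left_unitality (C : Cat.{v, u + 1}) :
    leftUnitorHom (freeObj C) = tensoratorHom (𝟙_ Cat.{v, u + 1}) C ≫ freeMap (λ_ C).hom :=
  tensor_free_ext fun a c => by
    have h := freeMap_incl (λ_ C).hom (a, c)
    simp [h]
    -- By eta, `a` is the object of the terminal category that defines `point`.
    exact leftUnitorHom_obj (C := freeObj C) _

theorem tensorator_right_unitality (C : Cat.{v, u + 1}) :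
    rightUnitorHom (freeObj C) = tensoratorHom C (𝟙_ Cat.{v, u + 1}) ≫ freeMap (ρ_ C).hom :=
  tensor_free_ext fun c a => by
    have h := freeMap_incl (ρ_ C).hom (c, a)
    simp [h]
    exact rightUnitorHom_obj (C := freeObj C) _

end Tensorator

/-! ### The monoidal functor and the induced monoids. -/

/-- The functor `free` is strong monoidal. -/
noncomputable def freeCoreMonoidal : free.{v, u}.CoreMonoidal where
  -- The tensor unit is by definition the free lex category on the terminal category.
  εIso := Iso.refl (free.obj (𝟙_ Cat.{v, u + 1}))
  μIso C D := tensoratorIso C D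
  μIso_hom_natural_left {X Y} f X' := by
    have h := tensorator_naturality f (𝟙 X')
    rw [tensorHom_id] at h
    -- Whiskering in `LexCat` uses the identity of `free X'`, whereas the naturality square has
    -- `free` applied to an identity.
    exact (congrArg (fun k => tensorMap (freeMap f) k ≫ tensoratorHom Y X')
      (free.map_id X').symm).trans h
  μIso_hom_natural_right {X Y} X' f := by
    have h := tensorator_naturality (𝟙 X') f
    rw [id_tensorHom] at h
    exact (congrArg (fun k => tensorMap k (freeMap f) ≫ tensoratorHom X' Y)
      (free.map_id X').symm).trans h
  associativity := tensorator_associativity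
  -- The whiskered `ε` in the unit axiom is a tensor of identities and drops out.
  left_unitality C := (tensorator_left_unitality C).trans
    ((congrArg (· ≫ _) tensorMap_id).trans (Category.id_comp _)).symm
  right_unitality C := (tensorator_right_unitality C).trans
    ((congrArg (· ≫ _) tensorMap_id).trans (Category.id_comp _)).symm

end LexCat

/-- The functor `free : Cat ⥤ LexCat` freely adding finite limits is strong monoidal, from the
cartesian product of categories to the tensor product of lex categories; its structure morphisms
are the identity of the free lex category on the terminal category and the comparison functors
`free C ⊗ free D ⟶ free (C × D)` sending `c ⊗ d` to `(c, d)` on generators. Consequently the free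
lex category on a monoid `M` in `Cat` (a strict monoidal category) is a monoid in `LexCat`, for
the structure induced by that of `M`. -/
theorem mainTheorem7 :
    ∃ F : (LexCat.free.{v, u}).Monoidal,
      F.ε = 𝟙 (LexCat.free.obj (𝟙_ Cat.{v, u + 1})) ∧
      (∀ C D : Cat.{v, u + 1},
        (LexCat.incl C).prod (LexCat.incl D) ⋙
            LexCat.tmul (LexCat.free.obj C) (LexCat.free.obj D) ⋙ (F.μ C D).toFunctor =
          LexCat.incl (C ⊗ D)) ∧
      ∀ (M : Cat.{v, u + 1}) [MonObj M],
        ∃ N : MonObj (LexCat.free.obj M),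
          N.one = F.ε ≫ LexCat.free.map MonObj.one ∧
          N.mul = F.μ M M ≫ LexCat.free.map MonObj.mul := by
  let F : (LexCat.free.{v, u}).Monoidal := LexCat.freeCoreMonoidal.toMonoidal
  -- The image of a monoid under a lax monoidal functor has exactly the required unit and
  -- multiplication, by definition.
  refine ⟨F, rfl, fun C D => ?_, fun M _ => ⟨LexCat.free.monObjObj M, rfl, rfl⟩⟩
  -- The target is thin, so this equality of functors is only an equality on pairs of generators.
  exact functor_eq_of_thin (D := (LexCat.freeObj (C ⊗ D)).carrier)
    fun p => LexCat.tensoratorHom_obj p.1 p.2
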